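/- Call a map $f : X \to Y$ of metric spaces an $(L,A)$-quasi-isometry, where $L \ge 1$ and $A \ge 0$, if $$L^{-1} d(x,y) - A \;\le\; d(f(x),f(y)) \;\le\; L\, d(x,y) + A \qquad\text{for all } x,y \in X,$$ and every point of $Y$ lies within distance $A$ of $f(X)$. Give $\mathbb{Z}$ the metric $d(m,n)=|m-n|$. For all real $L \ge 1$ and $A \ge 0$ there are constants $L'$ and $A'$, depending only on $L$ and $A$, such that the following holds. Let $U$ be an arbitrary group and let $\rho_0 : U \curvearrowright \mathbb{Z}$ be an action (a genuine action by bijections, not merely a quasi-action) such that $\rho_0(u) : \mathbb{Z} \to \mathbb{Z}$ is an $(L,A)$-quasi-isometry for every $u \in U$. Then there are an action $\rho_1 : U \curvearrowright \mathbb{Z}$ by isometries and a surjective $(L',A')$-quasi-isometry $f : \mathbb{Z} \to \mathbb{Z}$ that is equivariant, i.e. $f(\rho_0(u)(n)) = \rho_1(u)(f(n))$ for all $u \in U$ and $n \in \mathbb{Z}$. -/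

import Mathlib

/-- `f` is an `(L, A)`-quasi-isometry: `L ≥ 1`, `A ≥ 0`,
`L⁻¹ d(x, y) - A ≤ d(f x, f y) ≤ L d(x, y) + A` for all `x, y`, and every point of the target lies
within distance `A` of the image of `f`. -/
structure IsQuasiIsometry {X Y : Type*} [PseudoMetricSpace X] [PseudoMetricSpace Y]
    (L A : ℝ) (f : X → Y) : Prop where
  one_le : 1 ≤ L
  nonneg : 0 ≤ A
  lower : ∀ x y : X, L⁻¹ * dist x y - A ≤ dist (f x) (f y)
  upper : ∀ x y : X, dist (f x) (f y) ≤ L * dist x y + A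
  coarselySurjective : ∀ z : Y, ∃ x : X, dist (f x) z ≤ A

/-! A quasi-isometry of `ℤ` preserves or reverses the order of points more than `D` apart, with `D`
depending only on `L` and `A`, and these orientations form a homomorphism `ε` to `ℤˣ`. Intersecting
the translates of the usual order, twisted by `ε`, gives a strict partial order (`StablyBelow`) that
the action preserves or reverses according to `ε` and that contains every pair more than `D` apart.

Its lower sets and the complements of its upper sets are lower rays up to finite sets, so signed
counts of their differences make sense and are invariant under bijections. Adding the two counts
gives a height `N` whose differences transform by `ε` (`orientedHeight_map_sub`) and which stays
within `D` of `2x + 1`. Relabelling the range of `N` by `ℤ` in order gives `f`; the induced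
bijections of `ℤ` are monotone or antitone, hence isometries. -/

/-! ### Signed cardinality of the difference of two sets -/

/-- The signed number of elements by which `S` exceeds `T`. -/
noncomputable def Set.excess {α : Type*} (S T : Set α) : ℤ :=
  ((S \ T).ncard : ℤ) - (T \ S).ncard

theorem Set.excess_image {α : Type*} (e : Equiv.Perm α) (S T : Set α) :
    Set.excess (e '' S) (e '' T) = Set.excess S T := by
  unfold Set.excess
  rw [← Set.image_sdiff e.injective, ← Set.image_sdiff e.injective,
    Set.ncard_image_of_injective _ e.injective, Set.ncard_image_of_injective _ e.injective]

theorem Set.excess_compl {α : Type*} (S T : Set α) :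
    Set.excess Sᶜ Tᶜ = -Set.excess S T := by
  have h : ∀ A B : Set α, Aᶜ \ Bᶜ = B \ A := fun A B => by
    ext; simp [and_comm]
  simp [Set.excess, h]

theorem Set.excess_eq_of_subset {α : Type*} {R S T : Set α} (hS : R ⊆ S) (hT : R ⊆ T)
    (fS : (S \ R).Finite) (fT : (T \ R).Finite) :
    Set.excess S T = ((S \ R).ncard : ℤ) - (T \ R).ncard := by
  have key : ∀ A B : Set α, R ⊆ B → (A \ R) \ (B \ R) = A \ B := fun A B hB => by
    ext z
    have := @hB z
    simp only [Set.mem_sdiff]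
    tauto
  have h1 := Set.ncard_inter_add_ncard_sdiff_eq_ncard (S \ R) (T \ R) fS
  have h2 := Set.ncard_inter_add_ncard_sdiff_eq_ncard (T \ R) (S \ R) fT
  rw [key _ _ hT] at h1
  rw [key _ _ hS, Set.inter_comm] at h2
  unfold Set.excess
  omega

/-- The position of the upper end of a set of integers that agrees with a lower ray up to a
finite set. -/
noncomputable def Set.height (S : Set ℤ) : ℤ := Set.excess S (Set.Iio 0)

theorem Set.finite_sdiff_Iio {S : Set ℤ} {r b : ℤ} (hb : S ⊆ Set.Iio b) :
    (S \ Set.Iio r).Finite :=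
  (Set.finite_Ico r b).subset fun _ hz => ⟨not_lt.1 hz.2, hb hz.1⟩

theorem Set.ncard_Ico_int {a b : ℤ} (h : a ≤ b) : ((Set.Ico a b).ncard : ℤ) = b - a := by
  rw [← Finset.coe_Ico, Set.ncard_coe_finset, Int.card_Ico]
  omega

theorem Set.height_eq {S : Set ℤ} {r b : ℤ} (hr : r ≤ 0) (ha : Set.Iio r ⊆ S)
    (hb : S ⊆ Set.Iio b) : Set.height S = (S \ Set.Iio r).ncard + r := by
  have h0 : Set.Iio (0 : ℤ) \ Set.Iio r = Set.Ico r 0 := by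
    ext z; simp
  have := Set.excess_eq_of_subset ha (Set.Iio_subset_Iio hr) (Set.finite_sdiff_Iio hb)
    (Set.finite_sdiff_Iio (S := Set.Iio 0) subset_rfl)
  rw [h0, Set.ncard_Ico_int hr] at this
  unfold Set.height
  omega

theorem Set.excess_eq_height_sub {S T : Set ℤ} {a b c d : ℤ} (ha : Set.Iio a ⊆ S)
    (hb : S ⊆ Set.Iio b) (hc : Set.Iio c ⊆ T) (hd : T ⊆ Set.Iio d) :
    Set.excess S T = Set.height S - Set.height T := by
  obtain ⟨r, hra, hrc, hr⟩ : ∃ r, r ≤ a ∧ r ≤ c ∧ r ≤ 0 :=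
    ⟨min a (min c 0), by omega, by omega, by omega⟩
  have hS := (Set.Iio_subset_Iio hra).trans ha
  have hT := (Set.Iio_subset_Iio hrc).trans hc
  rw [Set.height_eq hr hS hb, Set.height_eq hr hT hd,
    Set.excess_eq_of_subset hS hT (Set.finite_sdiff_Iio hb) (Set.finite_sdiff_Iio hd)]
  ring

theorem Set.height_mem_Icc {S : Set ℤ} {a b : ℤ} (hab : a ≤ b) (ha : Set.Iio a ⊆ S)
    (hb : S ⊆ Set.Iio b) : Set.height S ∈ Set.Icc a b := by
  obtain ⟨r, hra, hr⟩ : ∃ r, r ≤ a ∧ r ≤ 0 := ⟨min a 0, by omega, by omega⟩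
  rw [Set.height_eq hr ((Set.Iio_subset_Iio hra).trans ha) hb]
  have h1 : (Set.Ico r a).ncard ≤ (S \ Set.Iio r).ncard :=
    Set.ncard_le_ncard (fun z hz => ⟨ha hz.2, not_lt.2 hz.1⟩) (Set.finite_sdiff_Iio hb)
  have h2 : (S \ Set.Iio r).ncard ≤ (Set.Ico r b).ncard :=
    Set.ncard_le_ncard (fun z hz => ⟨not_lt.1 hz.2, hb hz.1⟩) (Set.finite_Ico r b)
  have h3 := Set.ncard_Ico_int hra
  have h4 := Set.ncard_Ico_int (hra.trans hab)
  constructor <;> omega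

/-! ### The orientation of a quasi-isometry of `ℤ` -/

namespace IsQuasiIsometry

variable {L A : ℝ} {g : ℤ → ℤ}

theorem lt_abs_sub (hg : IsQuasiIsometry L A g) {C : ℝ} {x y : ℤ}
    (h : L * (C + A) < |(y : ℝ) - x|) : C < |(g y : ℝ) - g x| := by
  have h1 := hg.lower y x
  rw [Int.dist_eq, Int.dist_eq] at h1
  have hL : 0 < L := by linarith [hg.one_le]
  have h2 : C + A < L⁻¹ * |(y : ℝ) - x| := by
    rw [inv_mul_eq_div, lt_div_iff₀ hL]
    linarith
  linarith

/-- Both differences of values exceed `L + A` in size, while moving one endpoint by a unit changes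
the difference by at most `L + A`, so the sign cannot flip. -/
theorem pos_iff_of_step (hg : IsQuasiIsometry L A g) {x y x' y' : ℤ} (h : L * (L + A + A) < y - x)
    (hxy : (y' = y + 1 ∧ x' = x) ∨ (y' = y ∧ x' = x - 1)) :
    0 < g y' - g x' ↔ 0 < g y - g x := by
  have h1 : L + A < |(g y : ℝ) - g x| := hg.lt_abs_sub (h.trans_le (le_abs_self _))
  have h2 : L + A < |(g y' : ℝ) - g x'| := by
    refine hg.lt_abs_sub (lt_of_lt_of_le ?_ (le_abs_self _))
    rcases hxy with ⟨rfl, rfl⟩ | ⟨rfl, rfl⟩ <;> push_cast <;> linarith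
  have h3 : |((g y' : ℝ) - g x') - (g y - g x)| ≤ L + A := by
    rcases hxy with ⟨rfl, rfl⟩ | ⟨rfl, rfl⟩
    · have := hg.upper (y + 1) y
      rw [Int.dist_eq, Int.dist_eq] at this
      push_cast at this
      simpa using this
    · have := hg.upper x (x - 1)
      rw [Int.dist_eq, Int.dist_eq] at this
      push_cast at this
      simpa using this
  have h4 : (0 : ℝ) < g y' - g x' ↔ (0 : ℝ) < g y - g x := by
    have := abs_le.1 h3
    constructor <;> intro h5
    · rw [abs_of_pos h5] at h2; linarith
    · rw [abs_of_pos h5] at h1; linarith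
  exact_mod_cast h4

theorem pos_iff_of_le (hg : IsQuasiIsometry L A g) {x y x' y' : ℤ} (h : L * (L + A + A) < y - x)
    (hx : x' ≤ x) (hy : y ≤ y') : 0 < g y' - g x' ↔ 0 < g y - g x := by
  have hup : 0 < g y' - g x ↔ 0 < g y - g x := by
    induction y', hy using Int.leInduction with
    | base => rfl
    | succ z hz ih =>
      rw [← ih]
      have : (y : ℝ) ≤ z := by exact_mod_cast hz
      exact hg.pos_iff_of_step (by linarith) (Or.inl ⟨rfl, rfl⟩)
  have hy' : (y : ℝ) ≤ y' := by exact_mod_cast hy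
  rw [← hup]
  induction x', hx using Int.leInductionDown with
  | base => rfl
  | pred z hz ih =>
    have : (z : ℝ) ≤ x := by exact_mod_cast hz
    exact (hg.pos_iff_of_step (by linarith) (Or.inr ⟨rfl, rfl⟩)).trans ih

theorem pos_iff_pos (hg : IsQuasiIsometry L A g) {x y x' y' : ℤ} (h : L * (L + A + A) < y - x)
    (h' : L * (L + A + A) < y' - x') : 0 < g y - g x ↔ 0 < g y' - g x' := by
  -- Both pairs are compared with one interval containing them.
  rw [← hg.pos_iff_of_le h (min_le_left x x') (le_max_left y y'),
    ← hg.pos_iff_of_le h' (min_le_right x x') (le_max_right y y')]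

/-- A quasi-isometry of `ℤ` is coarsely increasing or coarsely decreasing. -/
theorem exists_orientation (hg : IsQuasiIsometry L A g) {D : ℕ} (hD : L * (L + A + A) ≤ D) :
    ∃ s : ℤˣ, ∀ x y : ℤ, x + D < y → 0 < (s : ℤ) * (g y - g x) := by
  have cast : ∀ {x y : ℤ}, x + D < y → L * (L + A + A) < (y : ℝ) - x := fun {x y} h => by
    have : (x : ℝ) + D < y := by exact_mod_cast h
    linarith
  have hne : ∀ {x y : ℤ}, x + D < y → g y - g x ≠ 0 := fun {x y} h h0 => by
    have h1 : L + A < |(g y : ℝ) - g x| := hg.lt_abs_sub ((cast h).trans_le (le_abs_self _))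
    have h2 : (g y : ℝ) - g x = 0 := by exact_mod_cast h0
    rw [h2, abs_zero] at h1
    linarith [hg.one_le, hg.nonneg]
  have h0 : (0 : ℤ) + D < D + 1 := by omega
  by_cases hp : 0 < g (D + 1) - g 0
  · refine ⟨1, fun x y hxy => ?_⟩
    have := (hg.pos_iff_pos (cast hxy) (cast h0)).2 hp
    simpa using this
  · refine ⟨-1, fun x y hxy => ?_⟩
    have h1 := mt (hg.pos_iff_pos (cast hxy) (cast h0)).1 hp
    have h2 := hne hxy
    rw [Units.val_neg, Units.val_one]
    omega

/-- Multiplicativity of the orientation needs a pair that is far apart both before and after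
applying `g`. -/
theorem exists_far_image (hg : IsQuasiIsometry L A g) (D : ℕ) :
    ∃ y : ℤ, (D : ℤ) < y ∧ (D : ℤ) < |g y - g 0| := by
  obtain ⟨n, hn⟩ := exists_nat_gt (max (D : ℝ) (L * (D + A)))
  refine ⟨n, by exact_mod_cast (le_max_left _ _).trans_lt hn, ?_⟩
  have : (D : ℝ) < |(g n : ℝ) - g 0| := by
    refine hg.lt_abs_sub ?_
    simpa using (le_max_right _ _).trans_lt hn
  exact_mod_cast this

end IsQuasiIsometry

theorem exists_orientation_hom {U : Type*} [Group U] {ρ : U →* Equiv.Perm ℤ} {L A : ℝ}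
    (h : ∀ u, IsQuasiIsometry L A (ρ u)) {D : ℕ} (hD : L * (L + A + A) ≤ D) :
    ∃ ε : U →* ℤˣ, ∀ u (x y : ℤ), x + D < y → 0 < (ε u : ℤ) * (ρ u y - ρ u x) := by
  choose s hs using fun u => (h u).exists_orientation hD
  refine ⟨MonoidHom.mk' s fun u v => ?_, hs⟩
  obtain ⟨y, hy, hv⟩ := (h v).exists_far_image D
  have h1 := hs v 0 y (by omega)
  have h2 := hs (u * v) 0 y (by omega)
  have h3 : 0 < (s u : ℤ) * (s v * (ρ u (ρ v y) - ρ u (ρ v 0))) := by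
    rcases Int.units_eq_one_or (s v) with e | e <;> rw [e] at h1 ⊢
    · rw [Units.val_one, one_mul] at h1 ⊢
      rw [abs_of_pos h1] at hv
      exact hs u _ _ (by omega)
    · rw [Units.val_neg, Units.val_one] at h1 ⊢
      rw [abs_of_neg (by omega)] at hv
      have := hs u (ρ v y) (ρ v 0) (by omega)
      linarith
  rw [map_mul, Equiv.Perm.mul_apply, Equiv.Perm.mul_apply] at h2
  rcases Int.units_eq_one_or (s u) with e | e <;> rcases Int.units_eq_one_or (s v) with e' | e' <;>
    rcases Int.units_eq_one_or (s (u * v)) with e'' | e'' <;> rw [e''] at h2 ⊢ <;>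
    rw [e, e'] at h3 ⊢ <;> simp at h2 h3 ⊢ <;> omega

/-! ### The invariant order and the height function of an oriented action on `ℤ` -/

section Oriented

variable {U : Type*} [Group U] (ρ : U →* Equiv.Perm ℤ) (ε : U →* ℤˣ)

/-- `x` lies below `y` in every translate of the order of `ℤ` by the oriented action. -/
def StablyBelow (x y : ℤ) : Prop := ∀ u, 0 < (ε u : ℤ) * (ρ u y - ρ u x)

variable {ρ ε}

theorem StablyBelow.lt {x y : ℤ} (h : StablyBelow ρ ε x y) : x < y := by
  simpa using h 1

theorem stablyBelow_iff_mul {x y : ℤ} (v : U) :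
    StablyBelow ρ ε x y ↔ ∀ u, 0 < (ε u : ℤ) * (ε v * (ρ u (ρ v y) - ρ u (ρ v x))) := by
  have key : ∀ u, (ε u : ℤ) * (ε v * (ρ u (ρ v y) - ρ u (ρ v x))) =
      (ε (u * v) : ℤ) * (ρ (u * v) y - ρ (u * v) x) := fun u => by
    simp [mul_assoc]
  -- Right translation by `v` permutes the group elements quantified over.
  simp only [key]
  exact ⟨fun h u => h _, fun h u => by simpa using h (u * v⁻¹)⟩

theorem stablyBelow_map_of_pos {v : U} (hv : ε v = 1) {x y : ℤ} :
    StablyBelow ρ ε (ρ v x) (ρ v y) ↔ StablyBelow ρ ε x y := by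
  rw [stablyBelow_iff_mul (x := x) v, hv]
  simp [StablyBelow]

theorem stablyBelow_map_of_neg {v : U} (hv : ε v = -1) {x y : ℤ} :
    StablyBelow ρ ε (ρ v y) (ρ v x) ↔ StablyBelow ρ ε x y := by
  rw [stablyBelow_iff_mul (x := x) v, hv]
  simp [StablyBelow]

variable (ρ ε)

/-- A canonical integer position of `x`, symmetric under reversal of the order. -/
noncomputable def orientedHeight (x : ℤ) : ℤ :=
  Set.height {z | StablyBelow ρ ε z x} + Set.height {z | StablyBelow ρ ε x z}ᶜ

variable {ρ ε} {D : ℕ}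

theorem Iio_subset_stablyBelow
    (h : ∀ u (x y : ℤ), x + D < y → 0 < (ε u : ℤ) * (ρ u y - ρ u x)) (x : ℤ) :
    Set.Iio (x - D) ⊆ {z | StablyBelow ρ ε z x} :=
  fun z hz u => h u z x (by rw [Set.mem_Iio] at hz; omega)

theorem stablyBelow_subset_Iio (x : ℤ) : {z | StablyBelow ρ ε z x} ⊆ Set.Iio x :=
  fun _ hz => StablyBelow.lt hz

theorem Iio_subset_compl_stablyAbove (x : ℤ) :
    Set.Iio (x + 1) ⊆ {z | StablyBelow ρ ε x z}ᶜ :=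
  fun z hz hxz => by
    have := StablyBelow.lt hxz
    rw [Set.mem_Iio] at hz
    omega

theorem compl_stablyAbove_subset_Iio
    (h : ∀ u (x y : ℤ), x + D < y → 0 < (ε u : ℤ) * (ρ u y - ρ u x)) (x : ℤ) :
    {z | StablyBelow ρ ε x z}ᶜ ⊆ Set.Iio (x + D + 1) :=
  fun z hz => by
    by_contra hlt
    rw [Set.mem_Iio] at hlt
    exact hz fun u => h u x z (by omega)

/-- The two summands lie in `[x - D, x]` and `[x + 1, x + D + 1]`. -/
theorem orientedHeight_mem_Icc
    (h : ∀ u (x y : ℤ), x + D < y → 0 < (ε u : ℤ) * (ρ u y - ρ u x)) (x : ℤ) :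
    orientedHeight ρ ε x ∈ Set.Icc (2 * x + 1 - D) (2 * x + 1 + D) := by
  have h1 := Set.height_mem_Icc (by omega) (Iio_subset_stablyBelow h x) (stablyBelow_subset_Iio x)
  have h2 := Set.height_mem_Icc (by omega) (Iio_subset_compl_stablyAbove x)
    (compl_stablyAbove_subset_Iio h x)
  rw [Set.mem_Icc] at h1 h2 ⊢
  unfold orientedHeight
  constructor <;> omega

/-- Taking differences removes the reference ray `Set.Iio 0`, which the action need not preserve. -/
theorem orientedHeight_sub
    (h : ∀ u (x y : ℤ), x + D < y → 0 < (ε u : ℤ) * (ρ u y - ρ u x)) (x y : ℤ) :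
    orientedHeight ρ ε y - orientedHeight ρ ε x =
      Set.excess {z | StablyBelow ρ ε z y} {z | StablyBelow ρ ε z x} -
        Set.excess {z | StablyBelow ρ ε y z} {z | StablyBelow ρ ε x z} := by
  have h1 := Set.excess_eq_height_sub (Iio_subset_stablyBelow h y) (stablyBelow_subset_Iio y)
    (Iio_subset_stablyBelow h x) (stablyBelow_subset_Iio x)
  have h2 := Set.excess_eq_height_sub (Iio_subset_compl_stablyAbove y)
    (compl_stablyAbove_subset_Iio h y) (Iio_subset_compl_stablyAbove x)
    (compl_stablyAbove_subset_Iio h x)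
  rw [Set.excess_compl] at h2
  unfold orientedHeight
  omega

/-- When `ε v = -1`, `ρ v` exchanges lower and upper sets, so the two excess terms swap and the
difference changes sign; this is why the height uses both. -/
theorem orientedHeight_map_sub
    (h : ∀ u (x y : ℤ), x + D < y → 0 < (ε u : ℤ) * (ρ u y - ρ u x)) (v : U) (x y : ℤ) :
    orientedHeight ρ ε (ρ v y) - orientedHeight ρ ε (ρ v x) =
      ε v * (orientedHeight ρ ε y - orientedHeight ρ ε x) := by
  rw [orientedHeight_sub h, orientedHeight_sub h]
  rcases Int.units_eq_one_or (ε v) with hv | hv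
  · have hb : ∀ x, {z | StablyBelow ρ ε z (ρ v x)} = ρ v '' {z | StablyBelow ρ ε z x} := fun x => by
      ext z
      obtain ⟨z, rfl⟩ := (ρ v).surjective z
      simp [stablyBelow_map_of_pos hv]
    have ha : ∀ x, {z | StablyBelow ρ ε (ρ v x) z} = ρ v '' {z | StablyBelow ρ ε x z} := fun x => by
      ext z
      obtain ⟨z, rfl⟩ := (ρ v).surjective z
      simp [stablyBelow_map_of_pos hv]
    simp only [hb, ha, Set.excess_image, hv, Units.val_one, one_mul]
  · have hb : ∀ x, {z | StablyBelow ρ ε z (ρ v x)} = ρ v '' {z | StablyBelow ρ ε x z} := fun x => by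
      ext z
      obtain ⟨z, rfl⟩ := (ρ v).surjective z
      simp [stablyBelow_map_of_neg hv]
    have ha : ∀ x, {z | StablyBelow ρ ε (ρ v x) z} = ρ v '' {z | StablyBelow ρ ε z x} := fun x => by
      ext z
      obtain ⟨z, rfl⟩ := (ρ v).surjective z
      simp [stablyBelow_map_of_neg hv]
    simp only [hb, ha, Set.excess_image, hv, Units.val_neg, Units.val_one]
    ring

end Oriented

/-! ### Reindexing the image of the height function -/

/-- A set of integers unbounded in both directions is order isomorphic to `ℤ`. -/
theorem exists_orderIso_int (S : Set ℤ) (hne : S.Nonempty) (hu : ∀ a ∈ S, ∃ b ∈ S, a < b)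
    (hl : ∀ a ∈ S, ∃ b ∈ S, b < a) : Nonempty (S ≃o ℤ) := by
  classical
  have : Nonempty S := hne.to_subtype
  have : NoMaxOrder S := ⟨fun a => by
    obtain ⟨b, hb, hab⟩ := hu a a.2
    exact ⟨⟨b, hb⟩, hab⟩⟩
  have : NoMinOrder S := ⟨fun a => by
    obtain ⟨b, hb, hab⟩ := hl a a.2
    exact ⟨⟨b, hb⟩, hab⟩⟩
  let _ : LocallyFiniteOrder S := inferInstanceAs (LocallyFiniteOrder {x // x ∈ S})
  let _ := LinearLocallyFiniteOrder.succOrder S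
  let _ := LinearLocallyFiniteOrder.predOrder S
  exact ⟨orderIsoIntOfLinearSuccPredArch⟩

theorem strictMono_int_sub_le {e : ℤ → ℤ} (he : StrictMono e) {a b : ℤ} (h : a ≤ b) :
    b - a ≤ e b - e a := by
  induction b, h using Int.leInduction with
  | base => simp
  | succ z hz ih =>
    have := he (lt_add_one z)
    omega

theorem int_sub_le_mul {e : ℤ → ℤ} {G : ℤ} (he : ∀ k, e (k + 1) ≤ e k + G) {a b : ℤ}
    (h : a ≤ b) : e b - e a ≤ G * (b - a) := by
  induction b, h using Int.leInduction with
  | base => simp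
  | succ z hz ih =>
    have := he z
    linarith

theorem isometry_of_strictMono_surjective {φ : ℤ → ℤ} (h : StrictMono φ)
    (hs : Function.Surjective φ) : Isometry φ := by
  have hstep : ∀ k, φ (k + 1) ≤ φ k + 1 := fun k => by
    -- The value `φ k + 1` is attained beyond `k`, so no step exceeds one.
    obtain ⟨j, hj⟩ := hs (φ k + 1)
    have : k < j := h.lt_iff_lt.1 (by omega)
    rw [← hj]
    exact h.monotone (by omega)
  have key : ∀ a b, a ≤ b → φ b - φ a = b - a := fun a b hab => by
    have h1 := strictMono_int_sub_le h hab
    have h2 := int_sub_le_mul hstep hab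
    omega
  refine Isometry.of_dist_eq fun a b => ?_
  rw [Int.dist_eq, Int.dist_eq]
  have : φ a - φ b = a - b := by
    rcases le_total a b with hab | hab
    · linarith [key a b hab]
    · exact key b a hab
  exact_mod_cast congrArg (fun t : ℤ => |t|) this

theorem isometry_of_strictAnti_surjective {φ : ℤ → ℤ} (h : StrictAnti φ)
    (hs : Function.Surjective φ) : Isometry φ := by
  have h1 : Isometry fun k => -φ k :=
    isometry_of_strictMono_surjective (fun a b hab => neg_lt_neg (h hab))
      (neg_surjective.comp hs)
  refine Isometry.of_dist_eq fun a b => ?_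
  rw [← h1.dist_eq a b, dist_neg_neg]

/-- An action descends along a surjection whose fibres it permutes. -/
theorem exists_equivariant_action {U X Y : Type*} [Group U] (ρ : U →* Equiv.Perm X) {f : X → Y}
    (hf : Function.Surjective f) (h : ∀ u x y, f x = f y → f (ρ u x) = f (ρ u y)) :
    ∃ σ : U →* Equiv.Perm Y, ∀ u x, f (ρ u x) = σ u (f x) := by
  obtain ⟨g, hg⟩ := hf.hasRightInverse
  have key : ∀ u x, f (ρ u (g (f x))) = f (ρ u x) := fun u x => h u _ _ (hg _)
  let act : MulAction U Y :=
    { smul := fun u y => f (ρ u (g y))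
      one_smul := fun y => by
        change f (ρ 1 (g y)) = y
        simp [hg y]
      mul_smul := fun u v y => by
        change f (ρ (u * v) (g y)) = f (ρ u (g (f (ρ v (g y)))))
        rw [key]
        simp }
  exact ⟨MulAction.toPermHom U Y, fun u x => (key u x).symm⟩

theorem mainTheorem4 (L A : ℝ) (hL : 1 ≤ L) (hA : 0 ≤ A) :
    ∃ L' A' : ℝ, ∀ (U : Type*) [Group U] (ρ₀ : U →* Equiv.Perm ℤ),
      (∀ u : U, IsQuasiIsometry L A (ρ₀ u)) →
      ∃ (ρ₁ : U →* Equiv.Perm ℤ) (f : ℤ → ℤ),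
        (∀ u : U, Isometry (ρ₁ u)) ∧
        Function.Surjective f ∧
        (∀ (u : U) (n : ℤ), f (ρ₀ u n) = ρ₁ u (f n)) ∧
        IsQuasiIsometry L' A' f := by
  obtain ⟨D, hD⟩ := exists_nat_ge (L * (L + A + A))
  -- Over a step of `D + 1`, the height strictly increases, by at most `2 * (D + 1) + 2 * D`; this
  -- bounds the gaps in its range.
  refine ⟨4 * D + 2, 2 * D, fun U _ ρ h => ?_⟩
  obtain ⟨ε, hε⟩ := exists_orientation_hom h hD
  set N : ℤ → ℤ := orientedHeight ρ ε with hN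
  have bound : ∀ x, 2 * x + 1 - D ≤ N x ∧ N x ≤ 2 * x + 1 + D := orientedHeight_mem_Icc hε
  have equi : ∀ v x y, N (ρ v y) - N (ρ v x) = ε v * (N y - N x) := orientedHeight_map_sub hε
  have up : ∀ x, N x < N (x + (D + 1)) := fun x => by
    have := bound x
    have := bound (x + (D + 1))
    omega
  have down : ∀ x, N (x - (D + 1)) < N x := fun x => by simpa using up (x - (D + 1))
  obtain ⟨e⟩ := exists_orderIso_int (Set.range N) (Set.range_nonempty N)
    (by rintro _ ⟨x, rfl⟩; exact ⟨_, ⟨_, rfl⟩, up x⟩)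
    (by rintro _ ⟨x, rfl⟩; exact ⟨_, ⟨_, rfl⟩, down x⟩)
  set f : ℤ → ℤ := fun x => e ⟨N x, x, rfl⟩ with hf
  have f_lt : ∀ {x y}, f x < f y ↔ N x < N y := fun {x y} => e.lt_iff_lt
  have f_eq : ∀ {x y}, f x = f y ↔ N x = N y := fun {x y} => e.injective.eq_iff.trans Subtype.ext_iff
  have f_surj : Function.Surjective f := fun k => by
    obtain ⟨x, hx⟩ := (e.symm k).2
    refine ⟨x, ?_⟩
    have : (⟨N x, x, rfl⟩ : Set.range N) = e.symm k := Subtype.ext hx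
    simp only [hf, this, OrderIso.apply_symm_apply]
  obtain ⟨σ, hσ⟩ := exists_equivariant_action ρ f_surj fun u x y hxy => by
    rw [f_eq] at hxy ⊢
    have := equi u x y
    rw [hxy, sub_self, mul_zero] at this
    omega
  refine ⟨σ, f, fun u => ?_, f_surj, hσ, ?_⟩
  · rcases Int.units_eq_one_or (ε u) with hu | hu
    · refine isometry_of_strictMono_surjective (fun a b hab => ?_) (σ u).surjective
      obtain ⟨x, rfl⟩ := f_surj a
      obtain ⟨y, rfl⟩ := f_surj b
      rw [← hσ, ← hσ, f_lt]
      rw [f_lt] at hab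
      have := equi u x y
      rw [hu, Units.val_one] at this
      omega
    · refine isometry_of_strictAnti_surjective (fun a b hab => ?_) (σ u).surjective
      obtain ⟨x, rfl⟩ := f_surj a
      obtain ⟨y, rfl⟩ := f_surj b
      rw [← hσ, ← hσ, f_lt]
      rw [f_lt] at hab
      have := equi u x y
      rw [hu, Units.val_neg, Units.val_one] at this
      omega
  · set i : ℤ → ℤ := fun k => (e.symm k : ℤ) with hi
    have i_f : ∀ x, i (f x) = N x := fun x => by simp [hi, hf]
    have i_mono : StrictMono i := fun a b hab => e.symm.strictMono hab
    have i_step : ∀ k, i (k + 1) ≤ i k + (4 * D + 2) := fun k => by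
      obtain ⟨x, rfl⟩ := f_surj k
      have h1 : f x + 1 ≤ f (x + (D + 1)) := f_lt.2 (up x)
      have h2 := i_mono.monotone h1
      rw [i_f] at h2 ⊢
      have := bound x
      have := bound (x + (D + 1))
      omega
    have upper : ∀ x y, |f x - f y| ≤ |N x - N y| := fun x y => by
      rcases le_total (f x) (f y) with hxy | hxy
      · have := strictMono_int_sub_le i_mono hxy
        rw [i_f, i_f] at this
        simp only [abs_eq_max_neg]
        omega
      · have := strictMono_int_sub_le i_mono hxy
        rw [i_f, i_f] at this
        simp only [abs_eq_max_neg]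
        omega
    have lower : ∀ x y, |N x - N y| ≤ (4 * D + 2) * |f x - f y| := fun x y => by
      rw [← i_f, ← i_f]
      rcases le_total (f x) (f y) with hxy | hxy
      · have := int_sub_le_mul i_step hxy
        rwa [abs_sub_comm, abs_sub_comm (f x), abs_of_nonneg (sub_nonneg.2 hxy),
          abs_of_nonneg (sub_nonneg.2 (i_mono.monotone hxy))]
      · have := int_sub_le_mul i_step hxy
        rwa [abs_of_nonneg (sub_nonneg.2 hxy),
          abs_of_nonneg (sub_nonneg.2 (i_mono.monotone hxy))]
    have hD0 : (0 : ℝ) ≤ D := Nat.cast_nonneg D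
    refine ⟨by linarith, by linarith, fun x y => ?_, fun x y => ?_, fun z => ?_⟩
    · rw [Int.dist_eq, Int.dist_eq]
      have h1 : 2 * |x - y| - 2 * D ≤ |N x - N y| := by
        have := bound x
        have := bound y
        simp only [abs_eq_max_neg]
        omega
      have h2 : 2 * |(x : ℝ) - y| - 2 * D ≤ (4 * D + 2) * |(f x : ℝ) - f y| := by
        exact_mod_cast h1.trans (lower x y)
      have h3 : (0 : ℝ) < 4 * D + 2 := by linarith
      rw [sub_le_iff_le_add, inv_mul_le_iff₀ h3]
      have h4 : (0 : ℝ) ≤ |(x : ℝ) - y| := abs_nonneg _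
      nlinarith
    · rw [Int.dist_eq, Int.dist_eq]
      have h1 : |f x - f y| ≤ 2 * |x - y| + 2 * D := by
        refine (upper x y).trans ?_
        have := bound x
        have := bound y
        simp only [abs_eq_max_neg]
        omega
      have h2 : |(f x : ℝ) - f y| ≤ 2 * |(x : ℝ) - y| + 2 * D := by exact_mod_cast h1
      have h4 : (0 : ℝ) ≤ |(x : ℝ) - y| := abs_nonneg _
      nlinarith
    · obtain ⟨x, rfl⟩ := f_surj z
      exact ⟨x, by simp⟩
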